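/- **Setting.** Let $n\in\mathbb N$ and let $\mathbb F_n^+$ be the unital free semigroup on generators $g_1,\dots,g_n$ with identity $g_0$; $|\alpha|$ is the length of the word $\alpha$. For an $n$-tuple $T=(T_1,\dots,T_n)$ of elements of an algebra put $T_\alpha=T_{i_1}\cdots T_{i_k}$ if $\alpha=g_{i_1}\cdots g_{i_k}$, and $T_{g_0}=I$. Let $\boldsymbol\mu=\{\mu_\alpha\}_{\alpha\in\mathbb F_n^+}$ be strictly positive reals with $\mu_{g_0}=1$, and let $$\boldsymbol\mu(\alpha,g_0)=\mu_{g_{i_1}g_{i_2}\cdots g_{i_k}}\,\mu_{g_{i_2}\cdots g_{i_k}}\cdots\mu_{g_{i_k}}\quad(\alpha=g_{i_1}\cdots g_{i_k}),\qquad \boldsymbol\mu(g_0,g_0)=1 .$$ Assume that for each $i$ $$\sup_{\alpha}\mu_{g_i\alpha}<\infty\qquad\text{and}\qquad \sup_{\alpha}\frac{\boldsymbol\mu(\alpha g_i,g_0)}{\boldsymbol\mu(\alpha,g_0)}<\infty .$$ Let $F^2(H_n)$ be the full Fock space with orthonormal basis $\{e_\alpha\}_{\alpha\in\mathbb F_n^+}$,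 and let $W=(W_1,\dots,W_n)$ be the weighted left multi-shift, $W_ie_\alpha=\mu_{g_i\alpha}e_{g_i\alpha}$. Let $F^2(\boldsymbol\mu)$ be the Hilbert space of formal power series $\sum_\alpha c_\alpha Z_\alpha$ in noncommuting indeterminates with $\sum_\alpha\boldsymbol\mu(\alpha,g_0)^2|c_\alpha|^2<\infty$, and let $U:F^2(H_n)\to F^2(\boldsymbol\mu)$ be the unitary with $Ue_\alpha=\boldsymbol\mu(\alpha,g_0)^{-1}Z_\alpha$. A formal power series $\varphi=\sum_\alpha c_\alpha Z_\alpha$ is a left multiplier if $\varphi\zeta\in F^2(\boldsymbol\mu)$ for all $\zeta\in F^2(\boldsymbol\mu)$; then $L_\varphi\zeta:=\varphi\zeta$ is bounded, and we write $\varphi(W)=U^*L_\varphi U$ and say that $\varphi(W)$ has the Fourier representation $\sum_\alpha c_\alpha W_\alpha$. The noncommutative Hardy algebra is $$F^\infty(\boldsymbol\mu)=\{\varphi(W):\ \varphi\text{ a left multiplier of }F^2(\boldsymbol\mu)\}\subset B(F^2(H_n)).$$ For a separable complex Hilbert space $\mathcal H$, let $\mathcal D_{\boldsymbol\mu}(\mathcal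 H)$ be the set of all $T\in B(\mathcal H)^n$ for which the series $\Sigma_{\boldsymbol\mu}(T,T^*)=\sum_{k=0}^\infty\sum_{|\alpha|=k}\boldsymbol\mu(\alpha,g_0)^{-2}\,T_\alpha T_\alpha^*$ converges in the weak operator topology. **Theorem.** Let $T=(T_1,\dots,T_n)\in\mathcal D_{\boldsymbol\mu}(\mathcal H)$. For every $\varphi(W)\in F^\infty(\boldsymbol\mu)$ with Fourier representation $\sum_\alpha c_\alpha W_\alpha$ the limit $$\Psi_T(\varphi(W))=\varphi(T):=\text{SOT-}\lim_{N\to\infty}\sum_{|\alpha|\le N}\Bigl(1-\frac{|\alpha|}{N+1}\Bigr)c_\alpha T_\alpha$$ exists in $B(\mathcal H)$, and the map $\Psi_T:F^\infty(\boldsymbol\mu)\to B(\mathcal H)$ so defined has the following properties. 1. For all $m\in\mathbb N$ and $c_\alpha\in\mathbb C$, $\sum_{|\alpha|\le m}c_\alpha W_\alpha\in F^\infty(\boldsymbol\mu)$ and $\Psi_T\bigl(\sum_{|\alpha|\le m}c_\alpha W_\alpha\bigr)=\sum_{|\alpha|\le m}c_\alpha T_\alpha$. 2. $\Psi_T$ is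 sequentially WOT-continuous and sequentially SOT-continuous: if $A_k,A\in F^\infty(\boldsymbol\mu)$ and $A_k\to A$ in WOT (respectively SOT), then $\Psi_T(A_k)\to\Psi_T(A)$ in WOT (respectively SOT). 3. $\Psi_T$ is a unital algebra homomorphism and is completely bounded, with $\|\Psi_T\|_{cb}\le\|\Sigma_{\boldsymbol\mu}(T,T^*)\|^{1/2}$. 4. $\Psi_T$ is $w^*$-continuous, where $F^\infty(\boldsymbol\mu)$ carries the relative $w^*$-topology of $B(F^2(H_n))$. 5. $r(\varphi(T))\le r(\varphi(W))$ for all $\varphi(W)\in F^\infty(\boldsymbol\mu)$, where $r(X)$ is the spectral radius of the operator $X$. -/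

import Mathlib

open Filter Topology

noncomputable section

namespace MultiShift

/-! ### The free semigroup and noncommutative power series -/

/-- The unital free semigroup on `n` generators: words in the letters `0, …, n - 1`. The product is
concatenation, the identity is the empty word, and the length is `List.length`. -/
abbrev Word (n : ℕ) := List (Fin n)

/-- The finite set of words of length `k`. -/
def wordsOfLength (n k : ℕ) : Finset (Word n) :=
  (Finset.univ : Finset (Fin k → Fin n)).image List.ofFn

theorem mem_wordsOfLength {n k : ℕ} {α : Word n} : α ∈ wordsOfLength n k ↔ α.length = k := by
  constructor
  · intro h
    obtain ⟨f, -, rfl⟩ := Finset.mem_image.1 h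
    simp
  · rintro rfl
    exact Finset.mem_image.2 ⟨α.get, Finset.mem_univ _, List.ofFn_get α⟩

/-- The finite set of words of length at most `N`. -/
def wordsUpTo (n N : ℕ) : Finset (Word n) :=
  (Finset.range (N + 1)).biUnion (wordsOfLength n)

theorem mem_wordsUpTo {n N : ℕ} {α : Word n} : α ∈ wordsUpTo n N ↔ α.length ≤ N := by
  simp [wordsUpTo, mem_wordsOfLength]

/-- `T_α = T_{i₁} ⋯ T_{iₖ}` for `α = g_{i₁} ⋯ g_{iₖ}`, and `T_α = 1` for the empty word. -/
def wordProd {n : ℕ} {R : Type*} [Monoid R] (T : Fin n → R) (α : Word n) : R :=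
  (α.map T).prod

/-- Formal power series `∑ c_α Z_α` in noncommuting indeterminates, given by their coefficients. -/
abbrev Series (n : ℕ) := Word n → ℂ

/-- The product of formal power series: the coefficient at `γ` is `∑ φ_α ζ_β` over all
factorizations `γ = αβ`; these are given by the initial segments `α` of `γ`. -/
def Series.conv {n : ℕ} (φ ζ : Series n) : Series n := fun γ =>
  ∑ k ∈ Finset.range (γ.length + 1), φ (γ.take k) * ζ (γ.drop k)

theorem Series.conv_assoc {n : ℕ} (φ ψ ζ : Series n) :
    (φ.conv ψ).conv ζ = φ.conv (ψ.conv ζ) := by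
  funext γ
  simp only [Series.conv, Finset.sum_mul, Finset.mul_sum]
  rw [Finset.sum_sigma', Finset.sum_sigma']
  refine Finset.sum_bij' (fun x _ => ⟨x.2, x.1 - x.2⟩) (fun x _ => ⟨x.1 + x.2, x.1⟩) ?_ ?_ ?_ ?_ ?_
  · rintro ⟨k, j⟩ h
    simp only [Finset.mem_sigma, Finset.mem_range, List.length_take, List.length_drop] at h ⊢
    omega
  · rintro ⟨k, j⟩ h
    simp only [Finset.mem_sigma, Finset.mem_range, List.length_take, List.length_drop] at h ⊢
    omega
  · rintro ⟨k, j⟩ h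
    simp only [Finset.mem_sigma, Finset.mem_range, List.length_take] at h
    have hk : j + (k - j) = k := by omega
    simp [hk]
  · rintro ⟨k, j⟩ h
    simp
  · rintro ⟨k, j⟩ h
    simp only [Finset.mem_sigma, Finset.mem_range, List.length_take] at h
    have hk : j + (k - j) = k := by omega
    have hj : min j k = j := by omega
    simp only [List.take_take, List.drop_take, List.drop_drop, hk, hj, mul_assoc]

/-! ### Weight sequences and the weighted left multi-shift -/

/-- `μ(α, g₀) = μ_{g_{i₁} ⋯ g_{iₖ}} μ_{g_{i₂} ⋯ g_{iₖ}} ⋯ μ_{g_{iₖ}}` for `α = g_{i₁} ⋯ g_{iₖ}`, and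
`μ(g₀, g₀) = 1`. -/
def weightProd {n : ℕ} (μ : Word n → ℝ) : Word n → ℝ
  | [] => 1
  | i :: α => μ (i :: α) * weightProd μ α

/-- A sequence of strictly positive weights `μ_α` with `μ_{g₀} = 1` that satisfies the two
boundedness conditions `sup_α μ_{g_i α} < ∞` and `sup_α μ(α g_i, g₀) / μ(α, g₀) < ∞`. -/
structure Weights (n : ℕ) where
  /-- the weights -/
  val : Word n → ℝ
  pos : ∀ α, 0 < val α
  one : val [] = 1
  bound_left : ∀ i, BddAbove (Set.range fun α : Word n => val (i :: α))
  bound_right : ∀ i,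
    BddAbove (Set.range fun α : Word n => weightProd val (α ++ [i]) / weightProd val α)

variable {n : ℕ}

/-- `μ(α, g₀)` for a weight sequence. -/
def Weights.prod (μ : Weights n) (α : Word n) : ℝ := weightProd μ.val α

theorem Weights.prod_pos (μ : Weights n) (α : Word n) : 0 < μ.prod α := by
  induction α with
  | nil => exact one_pos
  | cons i α ih => exact mul_pos (μ.pos _) ih

/-- The full Fock space on `n` generators, in the coordinates of its standard orthonormal basis
`e_α = e_{i₁} ⊗ ⋯ ⊗ e_{iₖ}`, `α = g_{i₁} ⋯ g_{iₖ}`. -/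
abbrev Fock (n : ℕ) := lp (fun _ : Word n => ℂ) 2

/-- The coordinates of `W_i ξ`: the map `e_α ↦ μ_{g_i α} e_{g_i α}`. -/
def shiftFun (μ : Word n → ℝ) (i : Fin n) (ξ : Word n → ℂ) : Word n → ℂ
  | [] => 0
  | j :: α => if j = i then (μ (j :: α) : ℂ) * ξ α else 0

theorem shiftFun_support (μ : Word n → ℝ) (i : Fin n) (ξ : Word n → ℂ) (γ : Word n)
    (h : γ ∉ Set.range (List.cons i)) : shiftFun μ i ξ γ = 0 := by
  cases γ with
  | nil => rfl
  | cons j α =>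
    have : j ≠ i := fun hj => h ⟨α, by rw [hj]⟩
    simp [shiftFun, this]

theorem Fock.summable_sq (ξ : Fock n) : Summable fun α => ‖ξ α‖ ^ 2 := by
  have := (memℓp_gen_iff (p := 2) (by norm_num)).1 ξ.2
  simpa using this

theorem Fock.norm_sq (ξ : Fock n) : ‖ξ‖ ^ 2 = ∑' α, ‖ξ α‖ ^ 2 := by
  have := lp.norm_rpow_eq_tsum (p := 2) (by norm_num) ξ
  simpa using this

theorem Weights.shift_bound (μ : Weights n) (i : Fin n) :
    ∃ C : ℝ, 0 ≤ C ∧ ∀ α, μ.val (i :: α) ≤ C := by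
  obtain ⟨C, hC⟩ := μ.bound_left i
  have h : ∀ α, μ.val (i :: α) ≤ C := fun α => hC ⟨α, rfl⟩
  exact ⟨C, (μ.pos _).le.trans (h []), h⟩

theorem shiftFun_sq_le (μ : Weights n) (i : Fin n) {C : ℝ} (hC : ∀ α, μ.val (i :: α) ≤ C)
    (ξ : Word n → ℂ) (α : Word n) :
    ‖shiftFun μ.val i ξ (i :: α)‖ ^ 2 ≤ C ^ 2 * ‖ξ α‖ ^ 2 := by
  have h : shiftFun μ.val i ξ (i :: α) = (μ.val (i :: α) : ℂ) * ξ α := by simp [shiftFun]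
  rw [h, norm_mul, mul_pow, Complex.norm_real, Real.norm_of_nonneg (μ.pos _).le]
  have := (μ.pos (i :: α)).le
  gcongr
  exact hC α

theorem shiftFun_summable (μ : Weights n) (i : Fin n) (ξ : Fock n) :
    Summable fun γ => ‖shiftFun μ.val i ξ γ‖ ^ 2 := by
  obtain ⟨C, -, hC⟩ := μ.shift_bound i
  rw [← (List.cons_injective (a := i)).summable_iff
    (fun γ h => by simp [shiftFun_support μ.val i ξ γ h])]
  exact Summable.of_nonneg_of_le (fun _ => sq_nonneg _)
    (fun α => shiftFun_sq_le μ i hC ξ α) ((Fock.summable_sq ξ).mul_left _)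

theorem shiftFun_memℓp (μ : Weights n) (i : Fin n) (ξ : Fock n) :
    Memℓp (shiftFun μ.val i ξ) 2 := by
  refine (memℓp_gen_iff (p := 2) (by norm_num)).2 ?_
  simpa using shiftFun_summable μ i ξ

/-- The weighted left multi-shift `W = (W₁, …, Wₙ)`: the bounded operators on the full Fock space
with `W_i e_α = μ_{g_i α} e_{g_i α}`. -/
def shift (μ : Weights n) (i : Fin n) : Fock n →L[ℂ] Fock n :=
  LinearMap.mkContinuousOfExistsBound
    { toFun := fun ξ => (⟨shiftFun μ.val i ξ, shiftFun_memℓp μ i ξ⟩ : Fock n)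
      map_add' := fun ξ η => by
        refine lp.ext (funext fun γ => ?_)
        change shiftFun μ.val i (ξ + η : Fock n) γ = shiftFun μ.val i ξ γ + shiftFun μ.val i η γ
        rcases γ with _ | ⟨j, α⟩
        · simp [shiftFun]
        · by_cases h : j = i <;> simp [shiftFun, h, mul_add]
      map_smul' := fun c ξ => by
        refine lp.ext (funext fun γ => ?_)
        change shiftFun μ.val i (c • ξ : Fock n) γ = c * shiftFun μ.val i ξ γ
        rcases γ with _ | ⟨j, α⟩
        · simp [shiftFun]
        · by_cases h : j = i <;> simp [shiftFun, h, mul_left_comm] }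
    (by
      obtain ⟨C, hC0, hC⟩ := μ.shift_bound i
      refine ⟨C, fun ξ => ?_⟩
      refine le_of_sq_le_sq ?_ (by positivity)
      rw [Fock.norm_sq, mul_pow, Fock.norm_sq, ← tsum_mul_left]
      have hinj := List.cons_injective (a := i)
      refine le_trans (le_of_eq (hinj.tsum_eq (f := fun γ => ‖shiftFun μ.val i ξ γ‖ ^ 2) ?_).symm) ?_
      · intro γ hγ
        by_contra h
        exact hγ (by simp [shiftFun_support μ.val i ξ γ h])
      · exact Summable.tsum_le_tsum (fun α => shiftFun_sq_le μ i hC ξ α)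
          ((shiftFun_summable μ i ξ).comp_injective hinj) ((Fock.summable_sq ξ).mul_left _))

theorem shift_single (μ : Weights n) (i : Fin n) (α : Word n) :
    shift μ i (lp.single 2 α 1) = (μ.val (i :: α) : ℂ) • lp.single 2 (i :: α) 1 := by
  refine lp.ext (funext fun γ => ?_)
  change shiftFun μ.val i (lp.single 2 α (1 : ℂ) : Fock n) γ
    = (μ.val (i :: α) : ℂ) * (lp.single 2 (i :: α) (1 : ℂ) : Fock n) γ
  rcases γ with _ | ⟨j, β⟩
  · simp [shiftFun]
  · by_cases h : j = i
    · subst h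
      by_cases hb : β = α
      · subst hb; simp [shiftFun]
      · simp [shiftFun, hb]
    · simp [shiftFun, h]

/-! ### The noncommutative Hardy algebra -/

/-- Membership in the Hilbert space `F²(μ)` of formal power series `ζ = ∑ c_α Z_α` with
`∑ μ(α, g₀)² |c_α|² < ∞`. -/
def MemF2 (μ : Weights n) (ζ : Series n) : Prop :=
  Summable fun α => μ.prod α ^ 2 * ‖ζ α‖ ^ 2

/-- `φ` is a left multiplier of `F²(μ)`: `φ ζ ∈ F²(μ)` for all `ζ ∈ F²(μ)`. -/
def IsLeftMultiplier (μ : Weights n) (φ : Series n) : Prop :=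
  ∀ ζ : Series n, MemF2 μ ζ → MemF2 μ (φ.conv ζ)

/-- The unitary `U` from the full Fock space to `F²(μ)`, `U e_α = μ(α, g₀)⁻¹ Z_α`. -/
def toSeries (μ : Weights n) (ξ : Fock n) : Series n := fun α => ξ α / (μ.prod α : ℂ)

/-- `A` has the Fourier representation `∑ c_α W_α`: the series `c = ∑ c_α Z_α` is a left multiplier
of `F²(μ)` and `A = U* L_c U`, where `L_c` is the left multiplication by `c`. -/
def HasFourierRep (μ : Weights n) (A : Fock n →L[ℂ] Fock n) (c : Series n) : Prop :=
  IsLeftMultiplier μ c ∧ ∀ ξ : Fock n, toSeries μ (A ξ) = c.conv (toSeries μ ξ)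

theorem MemF2.add {μ : Weights n} {ζ η : Series n} (hζ : MemF2 μ ζ) (hη : MemF2 μ η) :
    MemF2 μ (ζ + η) := by
  refine Summable.of_nonneg_of_le (fun _ => by positivity) (fun α => ?_)
    ((Summable.add hζ hη).mul_left 2)
  have h1 : ‖(ζ + η) α‖ ≤ ‖ζ α‖ + ‖η α‖ := norm_add_le _ _
  have h2 : ‖(ζ + η) α‖ ^ 2 ≤ 2 * (‖ζ α‖ ^ 2 + ‖η α‖ ^ 2) := by
    nlinarith [norm_nonneg ((ζ + η) α), sq_nonneg (‖ζ α‖ - ‖η α‖)]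
  nlinarith [sq_nonneg (μ.prod α)]

theorem MemF2.smul {μ : Weights n} {ζ : Series n} (hζ : MemF2 μ ζ) (a : ℂ) :
    MemF2 μ (a • ζ) := by
  refine (Summable.mul_left (‖a‖ ^ 2) hζ).congr fun α => ?_
  simp only [Pi.smul_apply, smul_eq_mul, norm_mul]
  ring

/-- The constant series `a`. -/
def constSeries (a : ℂ) : Series n
  | [] => a
  | _ :: _ => 0

theorem constSeries_conv (a : ℂ) (ζ : Series n) : (constSeries a).conv ζ = a • ζ := by
  funext γ
  simp only [Series.conv]
  rw [Finset.sum_range_succ', Finset.sum_eq_zero]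
  · simp [constSeries]
  · intro k hk
    rw [Finset.mem_range] at hk
    cases γ with
    | nil => simp at hk
    | cons i α => simp [constSeries]

theorem Series.add_conv (φ ψ ζ : Series n) : (φ + ψ).conv ζ = φ.conv ζ + ψ.conv ζ := by
  funext γ
  simp [Series.conv, add_mul, Finset.sum_add_distrib]

/-- The noncommutative Hardy algebra `F^∞(μ) = {U* L_φ U : φ a left multiplier of F²(μ)}`. -/
def hardyAlgebra (μ : Weights n) : Subalgebra ℂ (Fock n →L[ℂ] Fock n) where
  carrier := {A | ∃ c, HasFourierRep μ A c}
  mul_mem' := by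
    rintro A B ⟨a, ha, hA⟩ ⟨b, hb, hB⟩
    refine ⟨a.conv b, fun ζ hζ => ?_, fun ξ => ?_⟩
    · rw [Series.conv_assoc]
      exact ha _ (hb _ hζ)
    · rw [Series.conv_assoc, ← hB, ← hA]
      rfl
  add_mem' := by
    rintro A B ⟨a, ha, hA⟩ ⟨b, hb, hB⟩
    refine ⟨a + b, fun ζ hζ => ?_, fun ξ => ?_⟩
    · rw [Series.add_conv]
      exact (ha ζ hζ).add (hb ζ hζ)
    · rw [Series.add_conv, ← hB, ← hA]
      funext γ
      simp [toSeries, add_div]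
  algebraMap_mem' := by
    intro a
    refine ⟨constSeries a, fun ζ hζ => ?_, fun ξ => ?_⟩
    · rw [constSeries_conv]
      exact hζ.smul a
    · rw [constSeries_conv]
      funext γ
      simp [toSeries, Algebra.algebraMap_eq_smul_one, mul_div_assoc]

/-! ### Operator topologies and completely bounded maps -/

section Operators

variable {K : Type*} [NormedAddCommGroup K] [InnerProductSpace ℂ K]

/-- Convergence of a sequence of operators in the weak operator topology. -/
def TendstoWOT (A : ℕ → K →L[ℂ] K) (B : K →L[ℂ] K) : Prop :=
  Tendsto (fun k => ContinuousLinearMapWOT.ofCLM (A k)) atTop (𝓝 (ContinuousLinearMapWOT.ofCLM B))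

/-- Convergence of a sequence of operators in the strong operator topology. -/
def TendstoSOT (A : ℕ → K →L[ℂ] K) (B : K →L[ℂ] K) : Prop :=
  ∀ x : K, Tendsto (fun k => A k x) atTop (𝓝 (B x))

/-- The `w*` (ultraweak) topology of `B(K)`: the coarsest topology for which all the functionals
`A ↦ ∑ₖ ⟨A xₖ, yₖ⟩` with `∑ ‖xₖ‖² < ∞` and `∑ ‖yₖ‖² < ∞` are continuous. -/
@[reducible] def weakStarTopology (K : Type*) [NormedAddCommGroup K] [InnerProductSpace ℂ K] :
    TopologicalSpace (K →L[ℂ] K) :=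
  ⨅ (x : lp (fun _ : ℕ => K) 2) (y : lp (fun _ : ℕ => K) 2),
    TopologicalSpace.induced (fun A : K →L[ℂ] K => ∑' k, inner ℂ (y k) (A (x k))) inferInstance

/-- The operator on the direct sum of `m` copies of `K` given by an `m × m` matrix of operators. -/
def matrixOp {m : ℕ} (M : Matrix (Fin m) (Fin m) (K →L[ℂ] K)) :
    PiLp 2 (fun _ : Fin m => K) →L[ℂ] PiLp 2 (fun _ : Fin m => K) :=
  (PiLp.continuousLinearEquiv 2 ℂ (fun _ : Fin m => K)).symm.toContinuousLinearMap ∘L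
    (ContinuousLinearMap.pi fun i => ∑ j, M i j ∘L ContinuousLinearMap.proj j) ∘L
      (PiLp.continuousLinearEquiv 2 ℂ (fun _ : Fin m => K)).toContinuousLinearMap

theorem matrixOp_apply {m : ℕ} (M : Matrix (Fin m) (Fin m) (K →L[ℂ] K))
    (x : PiLp 2 (fun _ : Fin m => K)) (i : Fin m) : matrixOp M x i = ∑ j, M i j (x j) := by
  simp [matrixOp]

/-- The completely bounded norm `sup_m ‖u_m‖` of a linear map `u` from a space `V` of operators on
`K` to `B(H)`, where `u_m [A_{ij}] = [u(A_{ij})]` on `m × m` matrices; a supremum in `[0, ∞]`. -/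
def cbNorm {H : Type*} [NormedAddCommGroup H] [InnerProductSpace ℂ H]
    {V : Submodule ℂ (K →L[ℂ] K)} (u : V →ₗ[ℂ] (H →L[ℂ] H)) : ENNReal :=
  ⨆ (m : ℕ) (M : Matrix (Fin m) (Fin m) V)
    (_ : ‖matrixOp (M.map fun A => (A : K →L[ℂ] K))‖ ≤ 1), ‖matrixOp (M.map u)‖ₑ

end Operators

/-! ### The noncommutative Reinhardt set and the Cesàro means -/

section Reinhardt

variable {H : Type*} [NormedAddCommGroup H] [InnerProductSpace ℂ H] [CompleteSpace H]

/-- The series `∑ₖ ∑_{|α| = k} μ(α, g₀)⁻² T_α T_α*` converges to `S` in the weak operator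
topology. -/
def HasReinhardtSum (μ : Weights n) (T : Fin n → H →L[ℂ] H) (S : H →L[ℂ] H) : Prop :=
  TendstoWOT (fun N => ∑ k ∈ Finset.range N, ∑ α ∈ wordsOfLength n k,
    (((μ.prod α ^ 2)⁻¹ : ℝ) : ℂ) • (wordProd T α * ContinuousLinearMap.adjoint (wordProd T α))) S

/-- The noncommutative Reinhardt set `𝒟_μ(H)`. -/
def reinhardtSet (μ : Weights n) (H : Type*) [NormedAddCommGroup H] [InnerProductSpace ℂ H]
    [CompleteSpace H] : Set (Fin n → H →L[ℂ] H) :=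
  {T | ∃ S, HasReinhardtSum μ T S}

end Reinhardt

/-- The noncommutative polynomial `∑_{|α| ≤ m} c_α T_α`. -/
def polyEval {R : Type*} [Ring R] [Algebra ℂ R] (m : ℕ) (c : Series n) (T : Fin n → R) : R :=
  ∑ α ∈ wordsUpTo n m, c α • wordProd T α

/-- The Cesàro mean `∑_{|α| ≤ N} (1 - |α| / (N + 1)) c_α T_α`. -/
def cesaroMean {R : Type*} [Ring R] [Algebra ℂ R] (N : ℕ) (c : Series n) (T : Fin n → R) : R :=
  polyEval N (fun α => (1 - (α.length : ℂ) / (N + 1)) * c α) T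

end MultiShift

end

open MultiShift

noncomputable section

namespace MultiShift

variable {n : ℕ}

/-! ### Words, Fourier coefficients and the shift -/

/-! Write `∅` for the empty word. Positivity of the terms `μ(α, g₀)⁻² T_α T_α*` turns weak
convergence of their sum `S` into square summability of `μ(α, g₀)⁻¹ T_α* h`, with bound `‖S‖ ‖h‖²`.
Hence the Poisson kernel from `H` to `F² ⊗ H` is bounded, and its adjoint `R`, with `R(e_α ⊗ h) =
μ(α, g₀)⁻¹ T_α h`, has norm at most `√‖S‖`.

The calculus is `φ(T) h = R(φ(W) e_∅ ⊗ h)`. As `φ(W) e_∅ = ∑ c_α μ(α, g₀) e_α`, this is the sum of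
`c_α T_α h`, which converges unconditionally in norm (`hasSum_evalOp`); so the Cesàro means converge
strongly, and no radial limit is needed. Multiplicativity is the intertwining relation `φ(T) R(ξ ⊗
h) = R(φ(W) ξ ⊗ h)` (`evalOp_rowOp`), checked on basis vectors and used at `ξ = B e_∅`.

The other claims hold because `φ(T)` depends on `φ(W)` only through the vector `φ(W) e_∅`. Matrix
coefficients, and even `w*`-continuous functionals, of `φ(T)` have the form `⟨φ(W) e_∅, z⟩`. The
cb-bound follows from amplifying matrices by the identity of `H` and applying `R`
(`sum_norm_sq_sum_tensor_le`). Boundedness and Gelfand's formula give the spectral radius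
inequality. -/

theorem sum_wordsUpTo {M : Type*} [AddCommMonoid M] (N : ℕ) (f : Word n → M) :
    ∑ α ∈ wordsUpTo n N, f α = ∑ k ∈ Finset.range (N + 1), ∑ α ∈ wordsOfLength n k, f α := by
  refine Finset.sum_biUnion fun k _ l _ hkl => Finset.disjoint_left.2 fun α hk hl => hkl ?_
  rw [← mem_wordsOfLength.1 hk, ← mem_wordsOfLength.1 hl]

theorem wordsUpTo_mono : Monotone (wordsUpTo n) := fun _ _ h _ hα =>
  mem_wordsUpTo.2 ((mem_wordsUpTo.1 hα).trans h)

theorem tendsto_wordsUpTo : Tendsto (wordsUpTo n) atTop atTop :=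
  tendsto_atTop_finset_of_monotone wordsUpTo_mono fun α => ⟨α.length, mem_wordsUpTo.2 le_rfl⟩

/-- A word `α` enters the partial sums of index `|α|, …, N`, that is `N + 1 - |α|` of them. Dividing
by `N + 1` produces the Cesàro weights. -/
theorem sum_range_sum_wordsUpTo {M : Type*} [AddCommMonoid M] (N : ℕ) (f : Word n → M) :
    ∑ k ∈ Finset.range (N + 1), ∑ α ∈ wordsUpTo n k, f α
      = ∑ α ∈ wordsUpTo n N, (N + 1 - α.length) • f α := by
  rw [Finset.sum_comm' (t' := wordsUpTo n N)
    (s' := fun α => (Finset.range (N + 1)).filter fun k => α.length ≤ k)]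
  · refine Finset.sum_congr rfl fun α _ => ?_
    rw [Finset.sum_const]
    congr 1
    have : (Finset.range (N + 1)).filter (fun k => α.length ≤ k) = Finset.Ico α.length (N + 1) := by
      ext k
      simp [and_comm]
    rw [this, Nat.card_Ico]
  · intro k α
    simp only [Finset.mem_range, mem_wordsUpTo, Finset.mem_filter]
    omega

/-- Cesàro means of an unconditionally convergent series over words converge to its sum. -/
theorem tendsto_cesaro_of_hasSum {E : Type*} [NormedAddCommGroup E] [NormedSpace ℂ E]
    {f : Word n → E} {x : E} (hf : HasSum f x) :
    Tendsto (fun N : ℕ => ∑ α ∈ wordsUpTo n N, (1 - (α.length : ℂ) / (N + 1)) • f α)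
      atTop (𝓝 x) := by
  -- The shift by one is needed because the mean with parameter `N` averages the `N + 1` partial
  -- sums of index `0, …, N`.
  have h := ((hf.comp tendsto_wordsUpTo).cesaro_smul).comp (tendsto_add_atTop_nat 1)
  refine h.congr fun N => ?_
  simp only [Function.comp_apply]
  rw [sum_range_sum_wordsUpTo, Finset.smul_sum]
  refine Finset.sum_congr rfl fun α hα => ?_
  have hle : α.length ≤ N + 1 := (mem_wordsUpTo.1 hα).trans N.le_succ
  have hN : (N : ℂ) + 1 ≠ 0 := by exact_mod_cast N.succ_ne_zero
  rw [← Nat.cast_smul_eq_nsmul ℂ, ← Complex.coe_smul, smul_smul]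
  congr 1
  push_cast [hle]
  field_simp

/-- The basis vector `e_α` of the full Fock space. -/
abbrev basisVec (α : Word n) : Fock n := lp.single 2 α 1

theorem hasSum_basisVec (ξ : Fock n) : HasSum (fun α => ξ α • basisVec α) ξ := by
  simpa [basisVec, ← lp.single_smul] using lp.hasSum_single (p := 2) (by norm_num) ξ

theorem Fock.ext_basisVec {E : Type*} [NormedAddCommGroup E] [NormedSpace ℂ E]
    {A B : Fock n →L[ℂ] E} (h : ∀ α, A (basisVec α) = B (basisVec α)) : A = B := by
  ext ξ
  refine ((hasSum_basisVec ξ).mapL A).unique ?_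
  simpa [h] using (hasSum_basisVec ξ).mapL B

/-- The monomial `Z_α`. -/
def monomial (α : Word n) : Series n := Pi.single α 1

/-- Only the cut after `γ` leaves a final segment as long as `β`. With the next lemma, right
multiplication by `Z_β` is a pure relabelling of coefficients along `γ ↦ γβ`. -/
theorem Series.conv_monomial_apply (c : Series n) (β γ : Word n) :
    c.conv (monomial β) (γ ++ β) = c γ := by
  rw [Series.conv, Finset.sum_eq_single γ.length]
  · simp [monomial]
  · intro k hk hne
    rw [Finset.mem_range, List.length_append] at hk
    have : (γ ++ β).drop k ≠ β := fun h => hne <| by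
      have := congrArg List.length h
      simp at this
      omega
    simp [monomial, this]
  · intro h
    simp at h

theorem Series.conv_monomial_eq_zero (c : Series n) {β γ : Word n} (h : ¬ β <:+ γ) :
    c.conv (monomial β) γ = 0 := by
  refine Finset.sum_eq_zero fun k _ => ?_
  have : γ.drop k ≠ β := fun hk => h (hk ▸ List.drop_suffix k γ)
  simp [monomial, this]

theorem Series.conv_one (c : Series n) : c.conv (monomial []) = c :=
  funext fun γ => by simpa using c.conv_monomial_apply [] γ

theorem monomial_singleton_conv_cons (ζ : Series n) (i j : Fin n) (γ : Word n) :
    (monomial [i]).conv ζ (j :: γ) = if j = i then ζ γ else 0 := by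
  rw [Series.conv, Finset.sum_eq_single 1]
  · simp [monomial, Pi.single_apply]
  · intro k hk hne
    rw [Finset.mem_range, List.length_cons] at hk
    have : (j :: γ).take k ≠ [i] := fun h => hne <| by
      have := congrArg List.length h
      simp at this
      omega
    simp [monomial, this]
  · intro h
    simp at h

theorem monomial_singleton_conv_nil (ζ : Series n) (i : Fin n) :
    (monomial [i]).conv ζ [] = 0 := by
  simp [Series.conv, monomial]

theorem Weights.prod_ne_zero (μ : Weights n) (α : Word n) : (μ.prod α : ℂ) ≠ 0 :=
  Complex.ofReal_ne_zero.2 (μ.prod_pos α).ne'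

theorem toSeries_basisVec (μ : Weights n) (α : Word n) :
    toSeries μ (basisVec α) = ((μ.prod α : ℂ)⁻¹) • monomial α := by
  funext β
  by_cases h : β = α
  · subst h
    simp [toSeries, monomial]
  · simp [toSeries, monomial, h]

theorem memF2_toSeries (μ : Weights n) (ξ : Fock n) : MemF2 μ (toSeries μ ξ) := by
  refine (Fock.summable_sq ξ).congr fun α => ?_
  have h := (μ.prod_pos α).ne'
  simp only [toSeries, norm_div, Complex.norm_real, Real.norm_of_nonneg (μ.prod_pos α).le]
  field_simp

/-- Surjectivity of `U`: the multiplier property can be tested on the series `U ξ`, where it follows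
from a bounded operator on the Fock space. -/
theorem MemF2.exists_toSeries {μ : Weights n} {ζ : Series n} (h : MemF2 μ ζ) :
    ∃ ξ : Fock n, toSeries μ ξ = ζ := by
  refine ⟨⟨fun α => (μ.prod α : ℂ) * ζ α, (memℓp_gen_iff (p := 2) (by norm_num)).2 ?_⟩, ?_⟩
  · refine h.congr fun α => ?_
    simp [mul_pow]
  · funext α
    exact mul_div_cancel_left₀ _ (μ.prod_ne_zero α)

theorem Series.conv_smul (c ζ : Series n) (a : ℂ) : c.conv (a • ζ) = a • c.conv ζ := by
  funext γ
  simp [Series.conv, Finset.mul_sum, mul_left_comm]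

/-- The coefficients of the Fourier representation of `A` are read off from `A e_{g₀}`. -/
theorem HasFourierRep.toSeries_apply_basisVec {μ : Weights n} {A : Fock n →L[ℂ] Fock n}
    {c : Series n} (h : HasFourierRep μ A c) (β : Word n) :
    toSeries μ (A (basisVec β)) = ((μ.prod β : ℂ)⁻¹) • c.conv (monomial β) := by
  rw [h.2, toSeries_basisVec, Series.conv_smul]

theorem HasFourierRep.toSeries_apply_vacuum {μ : Weights n} {A : Fock n →L[ℂ] Fock n}
    {c : Series n} (h : HasFourierRep μ A c) : toSeries μ (A (basisVec [])) = c := by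
  rw [h.toSeries_apply_basisVec, Series.conv_one]
  simp [Weights.prod, weightProd]

theorem hasFourierRep_shift (μ : Weights n) (i : Fin n) :
    HasFourierRep μ (shift μ i) (monomial [i]) := by
  have key : ∀ ξ : Fock n, toSeries μ (shift μ i ξ) = (monomial [i]).conv (toSeries μ ξ) := by
    intro ξ
    funext γ
    rcases γ with _ | ⟨j, α⟩
    · rw [monomial_singleton_conv_nil]
      change shiftFun μ.val i ξ [] / _ = _
      simp [shiftFun]
    · rw [monomial_singleton_conv_cons]
      change shiftFun μ.val i ξ (j :: α) / _ = _
      have h1 : (μ.val (j :: α) : ℂ) ≠ 0 := Complex.ofReal_ne_zero.2 (μ.pos _).ne'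
      have h2 := μ.prod_ne_zero α
      -- This recursion for `μ(α, g₀)` is what cancels the weight of the shift.
      have h3 : (μ.prod (j :: α) : ℂ) = μ.val (j :: α) * μ.prod α := by
        simp [Weights.prod, weightProd]
      by_cases h : j = i
      · simp only [shiftFun, h, if_true, toSeries] at *
        rw [h3]
        field_simp
      · simp [shiftFun, h]
  refine ⟨fun ζ hζ => ?_, key⟩
  obtain ⟨ξ, rfl⟩ := hζ.exists_toSeries
  rw [← key]
  exact memF2_toSeries μ _

theorem polyEval_shift_mem (μ : Weights n) (m : ℕ) (c : Series n) :
    polyEval m c (shift μ) ∈ hardyAlgebra μ := by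
  refine Subalgebra.sum_mem _ fun α _ => Subalgebra.smul_mem _ ?_ _
  refine Subalgebra.list_prod_mem _ fun A hA => ?_
  obtain ⟨i, -, rfl⟩ := List.mem_map.1 hA
  exact ⟨_, hasFourierRep_shift μ i⟩

theorem polyEval_map {R S : Type*} [Ring R] [Algebra ℂ R] [Ring S] [Algebra ℂ S]
    (u : R →ₐ[ℂ] S) (m : ℕ) (c : Series n) (T : Fin n → R) :
    u (polyEval m c T) = polyEval m c fun i => u (T i) := by
  simp [polyEval, wordProd, map_list_prod, Function.comp_def]

variable {H : Type*} [NormedAddCommGroup H]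

/-! ### The full Fock space tensored with a Hilbert space -/

/-- The Hilbert tensor product of the full Fock space and `H`, realized as the space of square
summable families of vectors of `H` that are indexed by the words. -/
abbrev FockTensor (n : ℕ) (H : Type*) [NormedAddCommGroup H] := lp (fun _ : Word n => H) 2

theorem FockTensor.norm_sq (v : FockTensor n H) : ‖v‖ ^ 2 = ∑' α, ‖v α‖ ^ 2 := by
  simpa using lp.norm_rpow_eq_tsum (p := 2) (by norm_num) v

theorem FockTensor.summable_sq (v : FockTensor n H) : Summable fun α => ‖v α‖ ^ 2 := by
  simpa using (memℓp_gen_iff (p := 2) (by norm_num)).1 v.2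

variable [InnerProductSpace ℂ H]

theorem memℓp_smul_const (ξ : Fock n) (h : H) : Memℓp (fun α => ξ α • h) 2 := by
  refine (memℓp_gen_iff (p := 2) (by norm_num)).2 ?_
  simpa [norm_smul, mul_pow] using (Fock.summable_sq ξ).mul_right (‖h‖ ^ 2)

/-- The elementary tensors `ξ ⊗ h`, as a bounded bilinear map. -/
def tensor (n : ℕ) (H : Type*) [NormedAddCommGroup H] [InnerProductSpace ℂ H] :
    Fock n →L[ℂ] H →L[ℂ] FockTensor n H :=
  LinearMap.mkContinuous₂
    (LinearMap.mk₂ ℂ (fun ξ h => (⟨fun α => ξ α • h, memℓp_smul_const ξ h⟩ : FockTensor n H))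
      (fun ξ η h => lp.ext <| funext fun α => add_smul (ξ α) (η α) h)
      (fun a ξ h => lp.ext <| funext fun α => mul_smul a (ξ α) h)
      (fun ξ h k => lp.ext <| funext fun α => smul_add (ξ α) h k)
      (fun a ξ h => lp.ext <| funext fun α => smul_comm (ξ α) a h)) 1
    (fun ξ h => by
      refine le_of_sq_le_sq ?_ (by positivity)
      rw [FockTensor.norm_sq, one_mul, mul_pow, Fock.norm_sq, ← tsum_mul_right]
      simp [norm_smul, mul_pow])

theorem tensor_apply (ξ : Fock n) (h : H) (α : Word n) : tensor n H ξ h α = ξ α • h := rfl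

theorem norm_tensor (ξ : Fock n) (h : H) : ‖tensor n H ξ h‖ = ‖ξ‖ * ‖h‖ := by
  refine (sq_eq_sq₀ (norm_nonneg _) (by positivity)).1 ?_
  rw [FockTensor.norm_sq, mul_pow, Fock.norm_sq, ← tsum_mul_right]
  simp [tensor_apply, norm_smul, mul_pow]

theorem tensor_basisVec (α : Word n) (h : H) : tensor n H (basisVec α) h = lp.single 2 α h := by
  refine lp.ext (funext fun β => ?_)
  by_cases hb : β = α
  · subst hb
    simp [tensor_apply]
  · simp [tensor_apply, hb]

theorem norm_sq_sum_smul_of_orthonormal {ι : Type*} [Fintype ι] {f : ι → H}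
    (hf : Orthonormal ℂ f) (a : ι → ℂ) : ‖∑ k, a k • f k‖ ^ 2 = ∑ k, ‖a k‖ ^ 2 := by
  rw [← inner_self_eq_norm_sq (𝕜 := ℂ), hf.inner_sum a a Finset.univ]
  simp [Complex.conj_mul', ← Complex.ofReal_pow]

/-- Pythagoras' identity for tensors with an orthonormal family in the second factor. -/
theorem norm_sq_sum_tensor {ι : Type*} [Fintype ι] {f : ι → H} (hf : Orthonormal ℂ f)
    (u : ι → Fock n) : ‖∑ k, tensor n H (u k) (f k)‖ ^ 2 = ∑ k, ‖u k‖ ^ 2 := by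
  rw [FockTensor.norm_sq]
  simp_rw [Fock.norm_sq]
  rw [← Summable.tsum_finsetSum fun k _ => Fock.summable_sq (u k)]
  refine tsum_congr fun α => ?_
  have h1 : (∑ k, tensor n H (u k) (f k)) α = ∑ k, u k α • f k := by
    rw [lp.coeFn_sum, Finset.sum_apply]
    rfl
  rw [h1, norm_sq_sum_smul_of_orthonormal hf]

/-- The `m × m` matrix `[A_{ij}]` amplifies: the operator `[A_{ij} ⊗ I]` obeys the same bound on
the vectors `ξ ⊗ h_j`. -/
theorem sum_norm_sq_sum_tensor_le {m : ℕ} (M : Matrix (Fin m) (Fin m) (Fock n →L[ℂ] Fock n))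
    (ξ : Fock n) (h : Fin m → H) :
    ∑ i, ‖∑ j, tensor n H (M i j ξ) (h j)‖ ^ 2
      ≤ ‖matrixOp M‖ ^ 2 * (‖ξ‖ ^ 2 * ∑ j, ‖h j‖ ^ 2) := by
  -- The finitely many `h_j` are expanded in an orthonormal basis `f_k` of their span, so that `M ⊗
  -- I` acts on each `f_k`-component separately as `M`.
  let V : Submodule ℂ H := Submodule.span ℂ (Set.range h)
  have : FiniteDimensional ℂ V := FiniteDimensional.span_of_finite ℂ (Set.finite_range h)
  let b := stdOrthonormalBasis ℂ V
  let f : Fin (Module.finrank ℂ V) → H := fun k => b k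
  have hf : Orthonormal ℂ f := b.orthonormal.comp_linearIsometry V.subtypeₗᵢ
  let v : Fin m → V := fun j => ⟨h j, Submodule.subset_span ⟨j, rfl⟩⟩
  let a : Fin m → Fin (Module.finrank ℂ V) → ℂ := fun j k => b.repr (v j) k
  have ha : ∀ j, h j = ∑ k, a j k • f k := fun j => by
    have := congrArg (Subtype.val) (b.sum_repr (v j))
    rw [← show ((v j : V) : H) = h j from rfl, ← this]
    simp [a, f]
  have hn : ∀ j, ‖h j‖ ^ 2 = ∑ k, ‖a j k‖ ^ 2 := fun j => by
    rw [show ‖h j‖ = ‖v j‖ from rfl, ← b.repr.norm_map, EuclideanSpace.norm_sq_eq]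
  -- The `f_k`-component of the column `(ξ ⊗ h_j)_j`.
  let x : Fin (Module.finrank ℂ V) → PiLp 2 (fun _ : Fin m => Fock n) := fun k =>
    WithLp.toLp 2 fun j => a j k • ξ
  have hx : ∀ i, ∑ j, tensor n H (M i j ξ) (h j)
      = ∑ k, tensor n H (matrixOp M (x k) i) (f k) := fun i => by
    simp_rw [matrixOp_apply, map_sum, sum_apply]
    rw [Finset.sum_comm]
    refine Finset.sum_congr rfl fun j _ => ?_
    rw [ha j]
    simp [x, map_sum, map_smul]
  calc ∑ i, ‖∑ j, tensor n H (M i j ξ) (h j)‖ ^ 2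
      = ∑ k, ‖matrixOp M (x k)‖ ^ 2 := by
        simp_rw [hx, norm_sq_sum_tensor hf, PiLp.norm_sq_eq_of_L2]
        exact Finset.sum_comm
    _ ≤ ∑ k, (‖matrixOp M‖ * ‖x k‖) ^ 2 := by
        gcongr with k
        exact (matrixOp M).le_opNorm _
    _ = _ := by
        simp_rw [mul_pow, ← Finset.mul_sum, hn, PiLp.norm_sq_eq_of_L2]
        congr 1
        rw [Finset.mul_sum, Finset.sum_comm]
        refine Finset.sum_congr rfl fun j _ => ?_
        rw [Finset.mul_sum]
        refine Finset.sum_congr rfl fun k _ => ?_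
        simp [x, norm_smul, mul_pow, mul_comm]

/-! ### The Poisson kernel -/

variable [CompleteSpace H]

/-- The coordinates `μ(α, g₀)⁻¹ T_α* h` of the Poisson kernel. -/
def poissonFun (μ : Weights n) (T : Fin n → H →L[ℂ] H) (h : H) (α : Word n) : H :=
  ((μ.prod α : ℂ)⁻¹) • ContinuousLinearMap.adjoint (wordProd T α) h

/-- Tested against `h`, the partial sums of the Reinhardt series are increasing sums of these
squares, so their limit `⟨S h, h⟩` dominates every finite subsum. -/
theorem sum_norm_sq_poissonFun_le {μ : Weights n} {T : Fin n → H →L[ℂ] H} {S : H →L[ℂ] H}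
    (hS : HasReinhardtSum μ T S) (h : H) (s : Finset (Word n)) :
    ∑ α ∈ s, ‖poissonFun μ T h α‖ ^ 2 ≤ ‖S‖ * ‖h‖ ^ 2 := by
  have hlim := (ContinuousLinearMapWOT.tendsto_iff_forall_inner_apply_tendsto.1 hS h h).comp
    (tendsto_add_atTop_nat 1)
  have hre := (Complex.continuous_re.tendsto _).comp hlim
  have hterm : ∀ α : Word n, (inner ℂ h (((((μ.prod α ^ 2)⁻¹ : ℝ) : ℂ) •
      (wordProd T α * ContinuousLinearMap.adjoint (wordProd T α))) h)).re
        = ‖poissonFun μ T h α‖ ^ 2 := fun α => by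
    rw [smul_apply, inner_smul_right, mul_apply_eq_comp,
      ← ContinuousLinearMap.adjoint_inner_left, Complex.re_ofReal_mul,
      show (inner ℂ _ _ : ℂ).re = _ from inner_self_eq_norm_sq (𝕜 := ℂ) _, poissonFun, norm_smul,
      mul_pow, norm_inv, Complex.norm_real, Real.norm_of_nonneg (μ.prod_pos α).le, inv_pow]
  have hpart : ∀ N : ℕ, (Complex.re ∘ (fun a => inner ℂ h ((ContinuousLinearMapWOT.ofCLM
      (∑ k ∈ Finset.range a, ∑ α ∈ wordsOfLength n k, (((μ.prod α ^ 2)⁻¹ : ℝ) : ℂ) •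
      (wordProd T α * ContinuousLinearMap.adjoint (wordProd T α)))) h)) ∘ (· + 1)) N
        = ∑ α ∈ wordsUpTo n N, ‖poissonFun μ T h α‖ ^ 2 := fun N => by
    simp only [Function.comp_apply, ContinuousLinearMapWOT.ofCLM_apply]
    rw [← sum_wordsUpTo, sum_apply, inner_sum, Complex.re_sum]
    exact Finset.sum_congr rfl fun α _ => hterm α
  have hle : ∑ α ∈ s, ‖poissonFun μ T h α‖ ^ 2 ≤ (inner ℂ h (S h) : ℂ).re := by
    refine ge_of_tendsto (hre.congr hpart) ?_
    filter_upwards [tendsto_wordsUpTo.eventually_ge_atTop s] with N hN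
    exact Finset.sum_le_sum_of_subset_of_nonneg hN fun _ _ _ => sq_nonneg _
  calc _ ≤ (inner ℂ h (S h) : ℂ).re := hle
    _ ≤ ‖h‖ * ‖S h‖ := re_inner_le_norm (𝕜 := ℂ) h (S h)
    _ ≤ ‖h‖ * (‖S‖ * ‖h‖) := by gcongr; exact S.le_opNorm h
    _ = _ := by ring

theorem memℓp_poissonFun {μ : Weights n} {T : Fin n → H →L[ℂ] H} (hT : T ∈ reinhardtSet μ H)
    (h : H) : Memℓp (poissonFun μ T h) 2 := by
  obtain ⟨S, hS⟩ := hT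
  refine (memℓp_gen_iff (p := 2) (by norm_num)).2 ?_
  simpa using summable_of_sum_le (fun _ => sq_nonneg _) (sum_norm_sq_poissonFun_le hS h)

/-- The Poisson kernel as a linear map. -/
def poissonLinear {μ : Weights n} {T : Fin n → H →L[ℂ] H} (hT : T ∈ reinhardtSet μ H) :
    H →ₗ[ℂ] FockTensor n H where
  toFun h := ⟨poissonFun μ T h, memℓp_poissonFun hT h⟩
  map_add' h k := lp.ext <| funext fun α => by
    change poissonFun μ T (h + k) α = poissonFun μ T h α + poissonFun μ T k α
    simp [poissonFun]
  map_smul' a h := lp.ext <| funext fun α => by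
    change poissonFun μ T (a • h) α = a • poissonFun μ T h α
    simp [poissonFun, smul_comm a]

theorem norm_poissonLinear_le {μ : Weights n} {T : Fin n → H →L[ℂ] H}
    (hT : T ∈ reinhardtSet μ H) {S : H →L[ℂ] H} (hS : HasReinhardtSum μ T S) (h : H) :
    ‖poissonLinear hT h‖ ≤ √‖S‖ * ‖h‖ := by
  refine le_of_sq_le_sq ?_ (by positivity)
  rw [FockTensor.norm_sq, mul_pow, Real.sq_sqrt (norm_nonneg S)]
  exact (FockTensor.summable_sq (poissonLinear hT h)).tsum_le_of_sum_le
    (sum_norm_sq_poissonFun_le hS h)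

/-- The Poisson kernel `h ↦ ∑ e_α ⊗ μ(α, g₀)⁻¹ T_α* h` of `T ∈ 𝒟_μ(H)`. -/
def poissonKernel {μ : Weights n} {T : Fin n → H →L[ℂ] H} (hT : T ∈ reinhardtSet μ H) :
    H →L[ℂ] FockTensor n H :=
  (poissonLinear hT).mkContinuousOfExistsBound
    ⟨_, norm_poissonLinear_le hT hT.choose_spec⟩

theorem poissonKernel_apply {μ : Weights n} {T : Fin n → H →L[ℂ] H}
    (hT : T ∈ reinhardtSet μ H) (h : H) (α : Word n) :
    poissonKernel hT h α = ((μ.prod α : ℂ)⁻¹) • ContinuousLinearMap.adjoint (wordProd T α) h :=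
  rfl

/-- The row operator `v ↦ ∑ μ(α, g₀)⁻¹ T_α v_α`, the adjoint of the Poisson kernel. -/
def rowOp {μ : Weights n} {T : Fin n → H →L[ℂ] H} (hT : T ∈ reinhardtSet μ H) :
    FockTensor n H →L[ℂ] H :=
  ContinuousLinearMap.adjoint (poissonKernel hT)

theorem norm_rowOp_le {μ : Weights n} {T : Fin n → H →L[ℂ] H} (hT : T ∈ reinhardtSet μ H)
    {S : H →L[ℂ] H} (hS : HasReinhardtSum μ T S) : ‖rowOp hT‖ ≤ √‖S‖ := by
  rw [rowOp, LinearIsometryEquiv.norm_map]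
  exact ContinuousLinearMap.opNorm_le_bound _ (Real.sqrt_nonneg _) (norm_poissonLinear_le hT hS)

theorem rowOp_single {μ : Weights n} {T : Fin n → H →L[ℂ] H} (hT : T ∈ reinhardtSet μ H)
    (α : Word n) (h : H) :
    rowOp hT (lp.single 2 α h) = ((μ.prod α : ℂ)⁻¹) • wordProd T α h := by
  refine ext_inner_left ℂ fun k => ?_
  rw [rowOp, ContinuousLinearMap.adjoint_inner_right, lp.inner_single_right, poissonKernel_apply,
    inner_smul_left, inner_smul_right, ContinuousLinearMap.adjoint_inner_left]
  simp

variable {μ : Weights n} {T : Fin n → H →L[ℂ] H}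

/-! ### The functional calculus -/

/-- The bounded map `ξ ↦ R(ξ ⊗ h)` carries the unconditional expansion of `ξ` in the basis `e_α` to
an unconditional expansion in `H`. -/
theorem hasSum_rowOp_tensor (hT : T ∈ reinhardtSet μ H) (ξ : Fock n) (h : H) :
    HasSum (fun α => toSeries μ ξ α • wordProd T α h) (rowOp hT (tensor n H ξ h)) := by
  have key := (hasSum_basisVec ξ).mapL ((rowOp hT).comp ((tensor n H).flip h))
  simpa [tensor_basisVec, rowOp_single, smul_smul, toSeries, div_eq_mul_inv] using key

/-- The operator `h ↦ ∑ c_α T_α h`, where `∑ c_α Z_α` is the power series of `A e_{g₀}`. -/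
def evalOp (hT : T ∈ reinhardtSet μ H) (A : Fock n →L[ℂ] Fock n) : H →L[ℂ] H :=
  (rowOp hT).comp (tensor n H (A (basisVec [])))

theorem evalOp_apply (hT : T ∈ reinhardtSet μ H) (A : Fock n →L[ℂ] Fock n) (h : H) :
    evalOp hT A h = rowOp hT (tensor n H (A (basisVec [])) h) := rfl

theorem hasSum_evalOp (hT : T ∈ reinhardtSet μ H) {A : Fock n →L[ℂ] Fock n} {c : Series n}
    (hA : HasFourierRep μ A c) (h : H) :
    HasSum (fun α => c α • wordProd T α h) (evalOp hT A h) := by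
  simpa [hA.toSeries_apply_vacuum, evalOp_apply] using hasSum_rowOp_tensor hT (A (basisVec [])) h

theorem wordProd_append {R : Type*} [Monoid R] (T : Fin n → R) (α β : Word n) :
    wordProd T (α ++ β) = wordProd T α * wordProd T β := by
  simp [wordProd]

/-- The row operator intertwines `A ⊗ I` and `A(T)`. -/
theorem evalOp_rowOp (hT : T ∈ reinhardtSet μ H) {A : Fock n →L[ℂ] Fock n} {c : Series n}
    (hA : HasFourierRep μ A c) (ξ : Fock n) (h : H) :
    evalOp hT A (rowOp hT (tensor n H ξ h)) = rowOp hT (tensor n H (A ξ) h) := by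
  suffices hext : (evalOp hT A).comp ((rowOp hT).comp ((tensor n H).flip h))
      = ((rowOp hT).comp ((tensor n H).flip h)).comp A from DFunLike.congr_fun hext ξ
  refine Fock.ext_basisVec fun β => ?_
  change evalOp hT A (rowOp hT (tensor n H (basisVec β) h))
    = rowOp hT (tensor n H (A (basisVec β)) h)
  rw [tensor_basisVec, rowOp_single, map_smul]
  refine ((hasSum_evalOp hT hA (wordProd T β h)).const_smul ((μ.prod β : ℂ)⁻¹)).unique ?_
  have hsum := hasSum_rowOp_tensor hT (A (basisVec β)) h
  -- The series of `A e_β` is a multiple of `c Z_β`, supported on the words `γβ`; the sum is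
  -- reindexed by `γ`, and `T_{γβ} = T_γ T_β` finishes the comparison.
  rw [hA.toSeries_apply_basisVec, ← (List.append_left_injective β).hasSum_iff] at hsum
  · simpa [Function.comp_def, Series.conv_monomial_apply, wordProd_append, smul_smul, mul_comm]
      using hsum
  · intro γ hγ
    have : ¬ β <:+ γ := fun ⟨α, hα⟩ => hγ ⟨α, hα⟩
    simp [Series.conv_monomial_eq_zero c this]

theorem evalOp_mul (hT : T ∈ reinhardtSet μ H) {A : Fock n →L[ℂ] Fock n} {c : Series n}
    (hA : HasFourierRep μ A c) (B : Fock n →L[ℂ] Fock n) :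
    evalOp hT (A * B) = evalOp hT A * evalOp hT B :=
  ContinuousLinearMap.ext fun h => (evalOp_rowOp hT hA (B (basisVec [])) h).symm

theorem evalOp_one (hT : T ∈ reinhardtSet μ H) : evalOp hT 1 = 1 := by
  ext h
  change rowOp hT (tensor n H (basisVec []) h) = h
  rw [tensor_basisVec, rowOp_single]
  simp [Weights.prod, weightProd, wordProd]

/-- The functional calculus `φ(W) ↦ φ(T)` on the noncommutative Hardy algebra. -/
def functionalCalculus (hT : T ∈ reinhardtSet μ H) : hardyAlgebra μ →ₐ[ℂ] (H →L[ℂ] H) :=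
  AlgHom.ofLinearMap
    { toFun := fun A => evalOp hT A
      map_add' := fun A B => by ext h; simp [evalOp_apply]
      map_smul' := fun a A => by ext h; simp [evalOp_apply] }
    (evalOp_one hT) (fun A B => evalOp_mul hT A.2.choose_spec B)

theorem functionalCalculus_apply (hT : T ∈ reinhardtSet μ H) (A : hardyAlgebra μ) (h : H) :
    functionalCalculus hT A h
      = rowOp hT (tensor n H ((A : Fock n →L[ℂ] Fock n) (basisVec [])) h) := rfl

theorem tendstoSOT_cesaroMean (hT : T ∈ reinhardtSet μ H) (A : hardyAlgebra μ) {c : Series n}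
    (hA : HasFourierRep μ A c) :
    TendstoSOT (fun N => cesaroMean N c T) (functionalCalculus hT A) := fun h => by
  refine (tendsto_cesaro_of_hasSum (hasSum_evalOp hT hA h)).congr fun N => ?_
  simp [cesaroMean, polyEval, sum_apply, smul_smul]

theorem functionalCalculus_shift (hT : T ∈ reinhardtSet μ H) (i : Fin n)
    (hi : shift μ i ∈ hardyAlgebra μ) : functionalCalculus hT ⟨shift μ i, hi⟩ = T i := by
  ext h
  refine (hasSum_evalOp hT (hasFourierRep_shift μ i) h).unique ?_
  have hsum : HasSum (fun α => monomial [i] α • wordProd T α h)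
      (monomial [i] [i] • wordProd T [i] h) :=
    hasSum_single [i] fun α hα => by simp [monomial, hα]
  simpa [monomial, wordProd] using hsum

theorem functionalCalculus_polyEval (hT : T ∈ reinhardtSet μ H) (m : ℕ) (c : Series n) :
    functionalCalculus hT ⟨polyEval m c (shift μ), polyEval_shift_mem μ m c⟩ = polyEval m c T := by
  have hi : ∀ i, shift μ i ∈ hardyAlgebra μ := fun i => ⟨_, hasFourierRep_shift μ i⟩
  -- Both sides come from homomorphisms, so the identity reduces to the generators, where `W_i` goes
  -- to `T_i`.
  have h1 : (⟨polyEval m c (shift μ), polyEval_shift_mem μ m c⟩ : hardyAlgebra μ)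
      = polyEval m c fun i => ⟨shift μ i, hi i⟩ :=
    Subtype.ext (polyEval_map (hardyAlgebra μ).val m c fun i => ⟨shift μ i, hi i⟩).symm
  rw [h1, polyEval_map]
  simp [functionalCalculus_shift]

/-! ### Continuity -/

/-- Every matrix coefficient of `φ(T)` is a matrix coefficient of `φ(W)` at `e_{g₀}`. This transfers
weak convergence without any norm bound on the sequence. -/
theorem inner_functionalCalculus (hT : T ∈ reinhardtSet μ H) (A : hardyAlgebra μ) (h k : H) :
    inner ℂ k (functionalCalculus hT A h)
      = inner ℂ (ContinuousLinearMap.adjoint ((rowOp hT).comp ((tensor n H).flip h)) k)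
        ((A : Fock n →L[ℂ] Fock n) (basisVec [])) := by
  rw [ContinuousLinearMap.adjoint_inner_left]
  rfl

theorem tendstoWOT_functionalCalculus (hT : T ∈ reinhardtSet μ H) {A : ℕ → hardyAlgebra μ}
    {B : hardyAlgebra μ} (h : TendstoWOT (fun k => (A k : Fock n →L[ℂ] Fock n)) B) :
    TendstoWOT (fun k => functionalCalculus hT (A k)) (functionalCalculus hT B) := by
  refine ContinuousLinearMapWOT.tendsto_iff_forall_inner_apply_tendsto.2 fun x y => ?_
  simp only [ContinuousLinearMapWOT.ofCLM_apply, inner_functionalCalculus]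
  exact ContinuousLinearMapWOT.tendsto_iff_forall_inner_apply_tendsto.1 h _ _

theorem tendstoSOT_functionalCalculus (hT : T ∈ reinhardtSet μ H) {A : ℕ → hardyAlgebra μ}
    {B : hardyAlgebra μ} (h : TendstoSOT (fun k => (A k : Fock n →L[ℂ] Fock n)) B) :
    TendstoSOT (fun k => functionalCalculus hT (A k)) (functionalCalculus hT B) := fun x =>
  (((rowOp hT).comp ((tensor n H).flip x)).continuous.tendsto _).comp (h (basisVec []))

theorem norm_rowOp_comp_tensor_flip_le (hT : T ∈ reinhardtSet μ H) (h : H) :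
    ‖(rowOp hT).comp ((tensor n H).flip h)‖ ≤ ‖rowOp hT‖ * ‖h‖ := by
  refine ContinuousLinearMap.opNorm_le_bound _ (by positivity) fun ξ => ?_
  calc ‖rowOp hT (tensor n H ξ h)‖ ≤ ‖rowOp hT‖ * ‖tensor n H ξ h‖ := (rowOp hT).le_opNorm _
    _ = _ := by rw [norm_tensor]; ring

theorem summable_sq_of_lp {K : Type*} [NormedAddCommGroup K] (x : lp (fun _ : ℕ => K) 2) :
    Summable fun k => ‖x k‖ ^ 2 := by
  simpa using (memℓp_gen_iff (p := 2) (by norm_num)).1 x.2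

/-- A `w*`-continuous functional on `B(H)` pulls back to a vector functional `A ↦ ⟨A e_{g₀}, z⟩`. -/
theorem exists_tsum_inner_functionalCalculus (hT : T ∈ reinhardtSet μ H)
    (x y : lp (fun _ : ℕ => H) 2) :
    ∃ z : Fock n, ∀ A : hardyAlgebra μ, ∑' k, inner ℂ (y k) (functionalCalculus hT A (x k))
      = inner ℂ z ((A : Fock n →L[ℂ] Fock n) (basisVec [])) := by
  let u : ℕ → Fock n := fun k =>
    ContinuousLinearMap.adjoint ((rowOp hT).comp ((tensor n H).flip (x k))) (y k)
  -- The estimate `ab ≤ a² + b²` makes the vectors `u k` absolutely summable, so their sum can be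
  -- moved inside the inner product and represents the functional.
  have hu : Summable u := by
    refine Summable.of_norm_bounded (g := fun k => ‖rowOp hT‖ * (‖x k‖ ^ 2 + ‖y k‖ ^ 2))
      (((summable_sq_of_lp x).add (summable_sq_of_lp y)).mul_left _) fun k => ?_
    calc ‖u k‖ ≤ ‖(rowOp hT).comp ((tensor n H).flip (x k))‖ * ‖y k‖ := by
          refine (ContinuousLinearMap.le_opNorm _ _).trans_eq ?_
          rw [LinearIsometryEquiv.norm_map]
      _ ≤ ‖rowOp hT‖ * ‖x k‖ * ‖y k‖ := by gcongr; exact norm_rowOp_comp_tensor_flip_le hT _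
      _ ≤ _ := by
          rw [mul_assoc]
          gcongr
          nlinarith [sq_nonneg (‖x k‖ - ‖y k‖), sq_nonneg ‖x k‖, sq_nonneg ‖y k‖]
  refine ⟨∑' k, u k, fun A => ?_⟩
  simp_rw [inner_functionalCalculus]
  generalize (A : Fock n →L[ℂ] Fock n) (basisVec []) = ξ
  have h := (hu.hasSum.mapL (innerSL ℂ ξ)).star
  simp only [innerSL_apply_apply, RCLike.star_def, inner_conj_symm] at h
  exact h.tsum_eq

/-- Sequences supported at index `0` exhibit `A ↦ ⟨A ξ, z⟩` as one of the functionals that generate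
the `w*`-topology. -/
theorem tsum_inner_single (ξ z : Fock n) (A : Fock n →L[ℂ] Fock n) :
    ∑' k, inner ℂ ((lp.single 2 0 z : lp (fun _ : ℕ => Fock n) 2) k)
      (A ((lp.single 2 0 ξ : lp (fun _ : ℕ => Fock n) 2) k)) = inner ℂ z (A ξ) := by
  rw [tsum_eq_single 0 fun k hk => by simp [hk]]
  simp

theorem continuous_weakStar_functionalCalculus (hT : T ∈ reinhardtSet μ H) :
    @Continuous (hardyAlgebra μ) (H →L[ℂ] H)
      (TopologicalSpace.induced Subtype.val (weakStarTopology (Fock n)))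
      (weakStarTopology H) (functionalCalculus hT) := by
  -- It suffices to test the generating functionals of the target topology; each pulls back to a
  -- single vector functional at `e_{g₀}`.
  refine continuous_iInf_rng.2 fun x => continuous_iInf_rng.2 fun y => continuous_induced_rng.2 ?_
  obtain ⟨z, hz⟩ := exists_tsum_inner_functionalCalculus hT x y
  refine continuous_iff_le_induced.2 ?_
  have hval : (fun A : H →L[ℂ] H => ∑' k, inner ℂ (y k) (A (x k))) ∘ functionalCalculus hT
      = (fun A : Fock n →L[ℂ] Fock n => inner ℂ z (A (basisVec []))) ∘ Subtype.val :=
    funext hz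
  rw [hval, ← induced_compose]
  refine induced_mono ((iInf₂_le (lp.single 2 0 (basisVec [])) (lp.single 2 0 z)).trans_eq ?_)
  exact congrArg (fun f => TopologicalSpace.induced f _)
    (funext fun A => tsum_inner_single (basisVec []) z A)

/-! ### Norm and spectral radius estimates -/

/-- Each row of the image is `R` applied to a sum of tensors `M_{ij} e_{g₀} ⊗ x_j`. Thus `‖R‖`
factors out, and the amplification bound at the unit vector `e_{g₀}` does the rest. -/
theorem norm_matrixOp_functionalCalculus_le (hT : T ∈ reinhardtSet μ H) {m : ℕ}
    (M : Matrix (Fin m) (Fin m) (hardyAlgebra μ)) :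
    ‖matrixOp (M.map (functionalCalculus hT))‖
      ≤ ‖rowOp hT‖ * ‖matrixOp (M.map fun A => (A : Fock n →L[ℂ] Fock n))‖ := by
  refine ContinuousLinearMap.opNorm_le_bound _ (by positivity) fun x => ?_
  refine le_of_sq_le_sq ?_ (by positivity)
  have hi : ∀ i, matrixOp (M.map (functionalCalculus hT)) x i = rowOp hT (∑ j, tensor n H
      ((M.map fun A => (A : Fock n →L[ℂ] Fock n)) i j (basisVec [])) (x j)) := fun i => by
    rw [matrixOp_apply, map_sum]
    rfl
  rw [PiLp.norm_sq_eq_of_L2]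
  calc ∑ i, ‖matrixOp (M.map (functionalCalculus hT)) x i‖ ^ 2
      ≤ ∑ i, ‖rowOp hT‖ ^ 2 * ‖∑ j, tensor n H
        ((M.map fun A => (A : Fock n →L[ℂ] Fock n)) i j (basisVec [])) (x j)‖ ^ 2 := by
        refine Finset.sum_le_sum fun i _ => ?_
        rw [hi, ← mul_pow]
        gcongr
        exact (rowOp hT).le_opNorm _
    _ ≤ ‖rowOp hT‖ ^ 2 * (‖matrixOp (M.map fun A => (A : Fock n →L[ℂ] Fock n))‖ ^ 2
          * (‖(basisVec [] : Fock n)‖ ^ 2 * ∑ j, ‖x j‖ ^ 2)) := by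
        rw [← Finset.mul_sum]
        gcongr
        exact sum_norm_sq_sum_tensor_le _ _ _
    _ = _ := by
        rw [← PiLp.norm_sq_eq_of_L2, lp.norm_single (by norm_num)]
        simp
        ring

theorem cbNorm_functionalCalculus_le (hT : T ∈ reinhardtSet μ H) :
    cbNorm (V := Subalgebra.toSubmodule (hardyAlgebra μ)) (functionalCalculus hT).toLinearMap
      ≤ ENNReal.ofReal ‖rowOp hT‖ := by
  refine iSup_le fun m => iSup_le fun M => iSup_le fun hM => ?_
  rw [← ofReal_norm]
  refine ENNReal.ofReal_le_ofReal ?_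
  exact (norm_matrixOp_functionalCalculus_le hT M).trans
    (mul_le_of_le_one_right (norm_nonneg (rowOp hT)) hM)

theorem norm_functionalCalculus_le (hT : T ∈ reinhardtSet μ H) (A : hardyAlgebra μ) :
    ‖functionalCalculus hT A‖ ≤ ‖rowOp hT‖ * ‖(A : Fock n →L[ℂ] Fock n)‖ := by
  refine ContinuousLinearMap.opNorm_le_bound _ (by positivity) fun h => ?_
  have hA : ‖(A : Fock n →L[ℂ] Fock n) (basisVec [])‖ ≤ ‖(A : Fock n →L[ℂ] Fock n)‖ := by
    simpa using (A : Fock n →L[ℂ] Fock n).le_opNorm (basisVec [])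
  calc ‖functionalCalculus hT A h‖
      ≤ ‖rowOp hT‖ * (‖(A : Fock n →L[ℂ] Fock n) (basisVec [])‖ * ‖h‖) := by
        rw [functionalCalculus_apply, ← norm_tensor]
        exact (rowOp hT).le_opNorm _
    _ ≤ _ := by
        rw [mul_assoc]
        gcongr

/-- A bounded homomorphism defined on a subalgebra does not increase the spectral radius that is
taken in the ambient Banach algebra. -/
theorem spectralRadius_map_le {𝓐 𝓑 : Type*} [NormedRing 𝓐] [NormedAlgebra ℂ 𝓐] [CompleteSpace 𝓐]
    [NormedRing 𝓑] [NormedAlgebra ℂ 𝓑] [CompleteSpace 𝓑] {V : Subalgebra ℂ 𝓐} (u : V →ₐ[ℂ] 𝓑)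
    {C : ℝ} (hC : ∀ a, ‖u a‖ ≤ C * ‖(a : 𝓐)‖) (a : V) :
    spectralRadius ℂ (u a) ≤ spectralRadius ℂ (a : 𝓐) := by
  have h1 := spectrum.pow_nnnorm_pow_one_div_tendsto_nhds_spectralRadius (u a)
  have h2 := spectrum.pow_nnnorm_pow_one_div_tendsto_nhds_spectralRadius (a : 𝓐)
  -- The maximum with `1` keeps the constant nonzero even if `C ≤ 0`, so that `D^(1/k)` tends to `1`
  -- and disappears from Gelfand's formula.
  let D : NNReal := max C.toNNReal 1
  have hD : D ≠ 0 := (zero_lt_one.trans_le (le_max_right _ _)).ne'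
  have h3 : Tendsto (fun k : ℕ => (D : ENNReal) ^ (1 / k : ℝ)) atTop (𝓝 1) := by
    have h : Tendsto (fun k : ℕ => D ^ (1 / k : ℝ)) atTop (𝓝 (D ^ (0 : ℝ))) :=
      (tendsto_const_nhds (x := D)).nnrpow tendsto_one_div_atTop_nhds_zero_nat (Or.inl hD)
    rw [NNReal.rpow_zero] at h
    simpa only [ENNReal.coe_rpow_of_ne_zero hD, ENNReal.coe_one] using ENNReal.tendsto_coe.2 h
  have h4 := ENNReal.Tendsto.mul h3 (Or.inl one_ne_zero) h2 (Or.inr ENNReal.one_ne_top)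
  rw [one_mul] at h4
  refine le_of_tendsto_of_tendsto' h1 h4 fun k => ?_
  rw [← ENNReal.mul_rpow_of_nonneg _ _ (by positivity)]
  gcongr
  rw [← ENNReal.coe_mul, ENNReal.coe_le_coe, ← map_pow, ← NNReal.coe_le_coe]
  push_cast
  refine (hC (a ^ k)).trans ?_
  rw [SubmonoidClass.coe_pow]
  gcongr
  exact (Real.le_coe_toNNReal C).trans (by exact_mod_cast le_max_left _ _)

end MultiShift

end

theorem theorem5p1 {n : ℕ} (μ : Weights n)
    {H : Type*} [NormedAddCommGroup H] [InnerProductSpace ℂ H] [CompleteSpace H]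
    [TopologicalSpace.SeparableSpace H]
    (T : Fin n → H →L[ℂ] H) (hT : T ∈ reinhardtSet μ H) :
    ∃ Ψ : hardyAlgebra μ →ₐ[ℂ] (H →L[ℂ] H),
      -- the map is the SOT limit of the Cesaro means of the Fourier representation
      (∀ (A : hardyAlgebra μ) (c : Series n), HasFourierRep μ A c →
        TendstoSOT (fun N => cesaroMean N c T) (Ψ A)) ∧
      -- (i) it extends the polynomial calculus
      (∀ (m : ℕ) (c : Series n), ∃ hA : polyEval m c (shift μ) ∈ hardyAlgebra μ,
        Ψ ⟨polyEval m c (shift μ), hA⟩ = polyEval m c T) ∧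
      -- (ii) sequential WOT- and SOT-continuity
      (∀ (A : ℕ → hardyAlgebra μ) (B : hardyAlgebra μ),
        TendstoWOT (fun k => (A k : Fock n →L[ℂ] Fock n)) B →
          TendstoWOT (fun k => Ψ (A k)) (Ψ B)) ∧
      (∀ (A : ℕ → hardyAlgebra μ) (B : hardyAlgebra μ),
        TendstoSOT (fun k => (A k : Fock n →L[ℂ] Fock n)) B →
          TendstoSOT (fun k => Ψ (A k)) (Ψ B)) ∧
      -- (iii) complete boundedness and the bound for the cb-norm
      (cbNorm (V := Subalgebra.toSubmodule (hardyAlgebra μ)) Ψ.toLinearMap < ⊤ ∧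
        ∀ S : H →L[ℂ] H, HasReinhardtSum μ T S →
          cbNorm (V := Subalgebra.toSubmodule (hardyAlgebra μ)) Ψ.toLinearMap
            ≤ ENNReal.ofReal (Real.sqrt ‖S‖)) ∧
      -- (iv) continuity for the relative ultraweak topology of the Hardy algebra
      @Continuous (hardyAlgebra μ) (H →L[ℂ] H)
        (TopologicalSpace.induced Subtype.val (weakStarTopology (Fock n)))
        (weakStarTopology H) Ψ ∧
      -- (v) the spectral radius inequality
      (∀ A : hardyAlgebra μ,
        spectralRadius ℂ (Ψ A) ≤ spectralRadius ℂ (A : Fock n →L[ℂ] Fock n)) := by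
  refine ⟨functionalCalculus hT, fun A c => tendstoSOT_cesaroMean hT A,
    fun m c => ⟨polyEval_shift_mem μ m c, functionalCalculus_polyEval hT m c⟩,
    fun A B => tendstoWOT_functionalCalculus hT, fun A B => tendstoSOT_functionalCalculus hT,
    ⟨(cbNorm_functionalCalculus_le hT).trans_lt ENNReal.ofReal_lt_top, fun S hS => ?_⟩,
    continuous_weakStar_functionalCalculus hT,
    spectralRadius_map_le _ (norm_functionalCalculus_le hT)⟩
  exact (cbNorm_functionalCalculus_le hT).trans (ENNReal.ofReal_le_ofReal (norm_rowOp_le hT hS))
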